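/- Let $t,n\in\mathbb N$, $d=(d_1,\dots,d_t)$ with positive integers $d_i$ and $\sum_i d_i=n$, and let $h_1,\dots,h_t\ge 0$ be integers with $\sum_i h_i\le n$. In the $n\times n$ grid, with squares $(\text{row},\text{column})$ labelled as in a matrix, let the $k$-th block consist of the $d_k$ consecutive columns $d_1+\dots+d_{k-1}+1,\dots,d_1+\dots+d_k$, and let $B=B(h_1,d_1;\dots;h_t,d_t)$ be the Ferrers board in which each column of the $k$-th block consists of its top $h_1+\dots+h_k$ squares. A placement $C$ of $n$ non-attacking rooks on the grid corresponds to a permutation $\tau$ of $\{1,\dots,n\}$, the rooks being on the squares $(i,\tau_i)$. Call a square empty if it neither contains a rook nor lies to the right of a rook in its row. Dworkin's statistic $\xi(C,B)$ is the number of circles obtained as follows: for each rook on $B$, put a circle in each empty square of $B$ below it in its column; for each rook off $B$, put a circle in each empty square below it in its column and in each empty square of $B$ above it in its column. Let $M(d)$ be the set of words $\sigma=\sigma_1\cdots\sigma_n$ containing exactly $d_k$ letters $k$ for $1\le k\le t$. A placement $\tau$ is a graph of $\sigma\in M(d)$ if for every $i$ the column $\tau_i$ lies in the $\sigma_i$-th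 block. For a set $D$ of consecutive columns in which $B$ has constant height (a section of $B$), with exactly $s$ of the rooks in $D$ on $B$, the placement is $D$-regular if the $s$ rooks in $D$ on $B$ are in the $s$ left-most columns of $D$, and both among the rooks in $D$ on $B$ and among the rooks in $D$ off $B$ the higher of any two rooks is further to the right. It is $B$-regular if it is $D$-regular for every section $D$ contained in one of the $t$ blocks. Then every $\sigma\in M(d)$ has exactly one $B$-regular graph $P(\sigma)$, and the statistic $\xi(\sigma,B):=\xi(P(\sigma),B)$ satisfies $$\sum_{\sigma\in M(d)}q^{\xi(\sigma,B)}=\frac{[n]!}{[d_1]!\,[d_2]!\cdots[d_t]!},\qquad [k]!:=\prod_{i=1}^k\frac{1-q^i}{1-q},$$ as an identity in the indeterminate $q$. -/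

import Mathlib

/-!
Rows and columns of the `n × n` grid are indexed by `Fin n` (so counted from `0`), a square is a
pair (row, column), row `0` is the top row and column `0` is the left-most column.
A placement of `n` non-attacking rooks on the grid is a permutation `τ` of `Fin n`: the rook of
row `i` is on the square `(i, τ i)`.
-/

namespace Rook

/-- Column (or letter) `j` belongs to the `k`-th of the `t` consecutive blocks of sizes
`d 0, d 1, …`. -/
def InBlock {t : ℕ} (d : Fin t → ℕ) (k : Fin t) (j : ℕ) : Prop :=
  ∑ m ∈ Finset.Iio k, d m ≤ j ∧ j < ∑ m ∈ Finset.Iic k, d m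

instance {t : ℕ} (d : Fin t → ℕ) (k : Fin t) (j : ℕ) : Decidable (InBlock d k j) := by
  unfold InBlock; infer_instance

/-- The Ferrers board `B(h₁,d₁;…;h_t,d_t)` in the `n × n` grid: the columns are cut from left to
right into blocks of `d₁, …, d_t` columns, and each column of the `k`-th block consists of its top
`h₁ + ⋯ + h_k` squares. -/
def board {t : ℕ} (n : ℕ) (h d : Fin t → ℕ) : Finset (Fin n × Fin n) :=
  {c | ∃ k, InBlock d k c.2 ∧ (c.1 : ℕ) < ∑ m ∈ Finset.Iic k, h m}

/-- A square is empty if it holds no rook and is not to the right of a rook in its row: the rook of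
its row is strictly to its right. -/
def IsEmptyCell {n : ℕ} (τ : Equiv.Perm (Fin n)) (c : Fin n × Fin n) : Prop :=
  c.2 < τ c.1

instance {n : ℕ} (τ : Equiv.Perm (Fin n)) (c : Fin n × Fin n) : Decidable (IsEmptyCell τ c) := by
  unfold IsEmptyCell; infer_instance

/-- The squares that receive a circle. Let `r` be the row of the rook in the column of the empty
square `c`. If this rook is on `B`, then `c` is circled when it is on `B` and below the rook.
If it is off `B`, then `c` is circled when it is below the rook, or on `B` and above the rook. -/
def IsCircled {n : ℕ} (B : Finset (Fin n × Fin n)) (τ : Equiv.Perm (Fin n))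
    (c : Fin n × Fin n) : Prop :=
  IsEmptyCell τ c ∧ ∃ r, τ r = c.2 ∧
    (((r, c.2) ∈ B ∧ c ∈ B ∧ r < c.1) ∨
      ((r, c.2) ∉ B ∧ (r < c.1 ∨ (c ∈ B ∧ c.1 < r))))

instance {n : ℕ} (B : Finset (Fin n × Fin n)) (τ : Equiv.Perm (Fin n)) (c : Fin n × Fin n) :
    Decidable (IsCircled B τ c) := by
  unfold IsCircled; infer_instance

/-- Dworkin's statistic `ξ(C, B)` of a placement of `n` rooks: the number of circles. -/
def xi {n : ℕ} (B : Finset (Fin n × Fin n)) (τ : Equiv.Perm (Fin n)) : ℕ :=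
  (Finset.univ.filter (IsCircled B τ)).card

/-- The number of squares of `B` in column `j`. -/
def colHeight {n : ℕ} (B : Finset (Fin n × Fin n)) (j : Fin n) : ℕ :=
  (B.filter fun c => c.2 = j).card

/-- A section of `B`: a set of consecutive columns in which `B` has constant height. -/
def IsSection {n : ℕ} (B : Finset (Fin n × Fin n)) (D : Set (Fin n)) : Prop :=
  D.OrdConnected ∧ ∀ j ∈ D, ∀ l ∈ D, colHeight B j = colHeight B l

/-- `D`-regular placements: among the columns of `D`, those whose rook is on `B` are all to the left
of those whose rook is off `B`; the rooks in `D` on `B` are in ascending order (the higher of two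
rooks is further to the right), and so are the rooks in `D` off `B`. -/
def IsRegularOn {n : ℕ} (B : Finset (Fin n × Fin n)) (D : Set (Fin n))
    (τ : Equiv.Perm (Fin n)) : Prop :=
  ∀ i k : Fin n, τ i ∈ D → τ k ∈ D →
    ((i, τ i) ∈ B → (k, τ k) ∉ B → τ i < τ k) ∧
    ((i, τ i) ∈ B → (k, τ k) ∈ B → i < k → τ k < τ i) ∧
    ((i, τ i) ∉ B → (k, τ k) ∉ B → i < k → τ k < τ i)

/-- `B`-regular placements for `B = B(h₁,d₁;…;h_t,d_t)`: `D`-regular for every section `D` of `B`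
lying in one of the `t` blocks of columns. If `h₂, …, h_t` are positive, every section lies in one
block. If some of them vanish, the same board has several representations, and the blocks
are those of the given one. -/
def IsRegular {t : ℕ} (n : ℕ) (h d : Fin t → ℕ) (τ : Equiv.Perm (Fin n)) : Prop :=
  ∀ D : Set (Fin n), IsSection (board n h d) D → (∃ k, ∀ j ∈ D, InBlock d k j) →
    IsRegularOn (board n h d) D τ

/-- `M(d)`: the permutations (as words of length `n`) of the multiset with `d k` copies of the
letter `k`, where `n` is the sum of the `d k`. -/
def words {t : ℕ} (n : ℕ) (d : Fin t → ℕ) : Finset (Fin n → Fin t) :=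
  {w | ∀ k, (Finset.univ.filter fun i => w i = k).card = d k}

/-- `τ` is a graph of the word `w`: replacing each entry of `τ 0, τ 1, …` by the index of its block
gives `w`. -/
def IsGraph {t n : ℕ} (d : Fin t → ℕ) (w : Fin n → Fin t) (τ : Equiv.Perm (Fin n)) : Prop :=
  ∀ i, InBlock d (w i) (τ i)

/-- The `B`-regular graph `P(w)` of `w` (meaningful as there is exactly one for `w ∈ M(d)`). -/
noncomputable def regularGraph {t n : ℕ} (h d : Fin t → ℕ) (w : Fin n → Fin t) :
    Equiv.Perm (Fin n) :=
  Classical.epsilon fun τ => IsGraph d w τ ∧ IsRegular n h d τ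

/-- `ξ(w, B) = ξ(P(w), B)` for a multiset permutation `w`. -/
noncomputable def xiWord {t n : ℕ} (h d : Fin t → ℕ) (w : Fin n → Fin t) : ℕ :=
  xi (board n h d) (regularGraph h d w)

/-- `[k] = (1 - q^k) / (1 - q)`, with `q` the variable of `ℚ(q)`. -/
noncomputable def qInt (k : ℕ) : RatFunc ℚ :=
  (1 - RatFunc.X ^ k) / (1 - RatFunc.X)

/-- `[k]! = [1] [2] ⋯ [k]`. -/
noncomputable def qFactorial (k : ℕ) : RatFunc ℚ :=
  ∏ i ∈ Finset.Icc 1 k, qInt i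

/-- The `q`-multinomial coefficient `[n]! / ([d₁]! ⋯ [d_t]!)`. -/
noncomputable def qMultinomial {t : ℕ} (n : ℕ) (d : Fin t → ℕ) : RatFunc ℚ :=
  qFactorial n / ∏ k, qFactorial (d k)

end Rook

namespace Rook

open Finset

/-! Read the rows cyclically upwards from the foot of a column of height `H`. A rook in that column
then has exactly the earlier rows as its candidates for circles (`isCircled_iff`), and regularity
says that columns increase with this rank inside each block (`isRegular_iff`). So the regular graph
sorts rows by letter, then by rank. Equal letters give no circle, and `xi` becomes `wordInv`, an
inversion number in which each letter `k` has its own ranking of the positions. The ranking is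
irrelevant to the distribution: choosing the positions of the smallest letter yields a q-binomial
for any injective ranking (`sum_powersetCard_crossInv`), and the remaining letters are treated by
induction (`sum_wordInv`). -/

/-! ### q-integers and q-factorials -/

theorem qFactorial_zero : qFactorial 0 = 1 := by simp [qFactorial]

theorem qFactorial_succ (k : ℕ) : qFactorial (k + 1) = qFactorial k * qInt (k + 1) := by
  rw [qFactorial, Finset.prod_Icc_succ_top (by omega), ← qFactorial]

theorem qInt_add (a b : ℕ) : qInt (a + b) = qInt a + RatFunc.X ^ a * qInt b := by
  unfold qInt
  ring

theorem one_sub_X_pow_ne_zero (k : ℕ) : (1 - RatFunc.X ^ (k + 1) : RatFunc ℚ) ≠ 0 := by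
  have h : (1 - Polynomial.X ^ (k + 1) : Polynomial ℚ) ≠ 0 := by
    intro h
    simpa using congrArg (Polynomial.eval 0) h
  have := (RatFunc.algebraMap_injective ℚ).ne h
  simpa using this

theorem qInt_succ_ne_zero (k : ℕ) : qInt (k + 1) ≠ 0 :=
  div_ne_zero (one_sub_X_pow_ne_zero k) (by simpa using one_sub_X_pow_ne_zero 0)

theorem qFactorial_ne_zero (k : ℕ) : qFactorial k ≠ 0 := by
  induction k with
  | zero => simp [qFactorial_zero]
  | succ k ih => rw [qFactorial_succ]; exact mul_ne_zero ih (qInt_succ_ne_zero k)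

/-! ### Subsets and q-binomial coefficients -/

/-- The number of pairs in `S × T` which `p` puts in decreasing order. -/
def crossInv {ι : Type*} (p : ι → ℕ) (S T : Finset ι) : ℕ :=
  #{x ∈ S ×ˢ T | p x.2 < p x.1}

theorem crossInv_eq_sum {ι : Type*} (p : ι → ℕ) (S T : Finset ι) :
    crossInv p S T = ∑ r ∈ S, #{c ∈ T | p c < p r} := by
  simp only [crossInv, Finset.card_filter, Finset.sum_product]

section Binomial

variable {ι : Type*} [DecidableEq ι] {p : ι → ℕ} {a : ι} {S T : Finset ι}

theorem crossInv_insert_right_of_max (ha : ∀ x ∈ S, p x ≤ p a) :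
    crossInv p S (insert a T) = crossInv p S T := by
  rw [crossInv_eq_sum, crossInv_eq_sum]
  refine Finset.sum_congr rfl fun r hr => ?_
  rw [Finset.filter_insert, if_neg (by simpa using ha r hr)]

theorem crossInv_insert_left_of_max (haS : a ∉ S) (ha : ∀ x ∈ T, p x < p a) :
    crossInv p (insert a S) T = #T + crossInv p S T := by
  rw [crossInv_eq_sum, crossInv_eq_sum, Finset.sum_insert haS, Finset.filter_true_of_mem ha]

/-- The inversion generating function of the `k`-subsets of a finite set, for any injective
ranking, is the `q`-binomial coefficient. -/
theorem sum_powersetCard_crossInv (hp : Function.Injective p) (A : Finset ι) :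
    ∀ k l : ℕ, k + l = #A →
      (∑ S ∈ A.powersetCard k, (RatFunc.X : RatFunc ℚ) ^ crossInv p S (A \ S)) *
        (qFactorial k * qFactorial l) = qFactorial #A := by
  induction A using Finset.induction_on_max_value p with
  | empty =>
    intro k l hkl
    obtain ⟨rfl, rfl⟩ : k = 0 ∧ l = 0 := by simpa using hkl
    simp [qFactorial_zero, crossInv]
  | insert a A haA hmax ih =>
    intro k l hkl
    rcases k with _ | k
    · obtain rfl : l = _ := by simpa using hkl
      simp [qFactorial_zero, crossInv]
    rcases l with _ | l
    · obtain hk : k + 1 = _ := by simpa using hkl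
      rw [hk, Finset.powersetCard_self]
      simp [qFactorial_zero, crossInv]
    rw [Finset.card_insert_of_notMem haA] at hkl ⊢
    have hlt : ∀ x ∈ A, p x < p a := fun x hx =>
      lt_of_le_of_ne (hmax x hx) (hp.ne fun h => haA (h ▸ hx))
    -- q-Pascal: the top-ranked `a` adds no inversion when outside `S`, and one for each of the `l +
    -- 1` elements of the complement when inside.
    rw [Finset.powersetCard_succ_insert haA, Finset.sum_union, Finset.sum_image]
    · have h1 : ∑ S ∈ A.powersetCard (k + 1),
          (RatFunc.X : RatFunc ℚ) ^ crossInv p S (insert a A \ S) =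
          ∑ S ∈ A.powersetCard (k + 1), RatFunc.X ^ crossInv p S (A \ S) := by
        refine Finset.sum_congr rfl fun S hS => ?_
        have hSA := (Finset.mem_powersetCard.1 hS).1
        rw [Finset.insert_sdiff_of_notMem _ fun h => haA (hSA h),
          crossInv_insert_right_of_max fun x hx => hmax x (hSA hx)]
      have h2 : ∑ S ∈ A.powersetCard k,
          (RatFunc.X : RatFunc ℚ) ^ crossInv p (insert a S) (insert a A \ insert a S) =
          RatFunc.X ^ (l + 1) *
            ∑ S ∈ A.powersetCard k, RatFunc.X ^ crossInv p S (A \ S) := by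
        rw [Finset.mul_sum]
        refine Finset.sum_congr rfl fun S hS => ?_
        obtain ⟨hSA, hcard⟩ := Finset.mem_powersetCard.1 hS
        have haS : a ∉ S := fun h => haA (hSA h)
        have hsd : insert a A \ insert a S = A \ S := by
          ext x
          simp only [Finset.mem_sdiff, Finset.mem_insert]
          grind
        rw [hsd, crossInv_insert_left_of_max haS fun x hx => hlt x (Finset.mem_sdiff.1 hx).1,
          pow_add, Finset.card_sdiff_of_subset hSA, hcard]
        congr 2
        omega
      have e1 := ih (k + 1) l (by omega)
      have e2 := ih k (l + 1) (by omega)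
      have e3 := qInt_add (l + 1) (k + 1)
      -- The order of the summands puts the factor `X ^ (l + 1)` of `qInt_add` where `h2` has it.
      rw [h1, h2, qFactorial_succ #A, show #A + 1 = l + 1 + (k + 1) by omega, e3]
      rw [qFactorial_succ k] at e1 ⊢
      rw [qFactorial_succ l] at e2 ⊢
      linear_combination qInt (l + 1) * e1 + RatFunc.X ^ (l + 1) * qInt (k + 1) * e2
    · intro S hS T hT hST
      have hS' : a ∉ S := fun h => haA ((Finset.mem_powersetCard.1 hS).1 h)
      have hT' : a ∉ T := fun h => haA ((Finset.mem_powersetCard.1 hT).1 h)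
      rw [← Finset.erase_insert hS', ← Finset.erase_insert hT', hST]
    · rw [Finset.disjoint_left]
      intro S hS hS'
      obtain ⟨T, -, rfl⟩ := Finset.mem_image.1 hS'
      exact haA ((Finset.mem_powersetCard.1 hS).1 (Finset.mem_insert_self a T))

end Binomial

/-! ### Words and q-multinomial coefficients -/

/-- Inversions of a word `w`, where the letters equal to `k` are compared with larger letters
through the ranking `p k` of the positions. -/
def wordInv {ι : Type*} [Fintype ι] {t : ℕ} (p : Fin t → ι → ℕ) (w : ι → Fin t) : ℕ :=
  #{x : ι × ι | w x.1 < w x.2 ∧ p (w x.1) x.2 < p (w x.1) x.1}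

/-- The word with letter `0` on `S` and the letters of `v`, raised by one, elsewhere. -/
def consWord {ι : Type*} [DecidableEq ι] {t : ℕ} (S : Finset ι) (v : {i // i ∉ S} → Fin t) :
    ι → Fin (t + 1) :=
  fun i => if h : i ∈ S then 0 else (v ⟨i, h⟩).succ

section Words

variable {ι : Type*} [DecidableEq ι] {t : ℕ}

theorem consWord_of_mem {S : Finset ι} {v : {i // i ∉ S} → Fin t} {i : ι} (hi : i ∈ S) :
    consWord S v i = 0 := by simp [consWord, hi]

theorem consWord_of_notMem {S : Finset ι} {v : {i // i ∉ S} → Fin t} {i : ι} (hi : i ∉ S) :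
    consWord S v i = (v ⟨i, hi⟩).succ := by simp [consWord, hi]

theorem consWord_eq_zero_iff {S : Finset ι} {v : {i // i ∉ S} → Fin t} {i : ι} :
    consWord S v i = 0 ↔ i ∈ S := by
  by_cases hi : i ∈ S
  · simp [consWord, hi]
  · simp [consWord, hi, Fin.succ_ne_zero]

theorem card_consWord_succ [Fintype ι] (S : Finset ι) (v : {i // i ∉ S} → Fin t) (k : Fin t) :
    #{i | consWord S v i = k.succ} = #{i | v i = k} := by
  symm
  refine Finset.card_bij (fun i _ => i.1) ?_ (fun _ _ _ _ h => Subtype.ext h) ?_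
  · rintro ⟨i, hi⟩ h
    simpa [consWord_of_notMem hi] using h
  · intro i h
    have hi : i ∉ S := fun hi => by
      simp [consWord_of_mem hi, (Fin.succ_ne_zero k).symm] at h
    exact ⟨⟨i, hi⟩, by simpa [consWord_of_notMem hi] using h, rfl⟩

/-- The smaller letter of an inversion decides the ranking. If it is `0`, the other position is any
lower-ranked one outside `S`; otherwise both positions lie outside `S`. -/
theorem wordInv_consWord [Fintype ι] (p : Fin (t + 1) → ι → ℕ) (S : Finset ι) (v : {i // i ∉ S} → Fin t) :
    wordInv p (consWord S v) =
      crossInv (p 0) S Sᶜ + wordInv (fun k i => p k.succ i.1) v := by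
  rw [wordInv, ← Finset.card_filter_add_card_filter_not (fun x : ι × ι => x.1 ∈ S)]
  congr 1
  · rw [crossInv]
    congr 1
    ext ⟨r, c⟩
    simp only [Finset.mem_filter, Finset.mem_univ, true_and, Finset.mem_product,
      Finset.mem_compl]
    by_cases hr : r ∈ S
    · simp only [hr, consWord_of_mem hr, Fin.pos_iff_ne_zero, ne_eq, consWord_eq_zero_iff]
      tauto
    · simp [hr]
  · rw [wordInv]
    symm
    refine Finset.card_bij (fun x _ => (x.1.1, x.2.1)) ?_ ?_ ?_
    · rintro ⟨⟨r, hr⟩, c, hc⟩ h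
      simpa [consWord_of_notMem hr, consWord_of_notMem hc, hr] using h
    · rintro ⟨⟨r, hr⟩, c, hc⟩ - ⟨⟨r', hr'⟩, c', hc'⟩ - h
      simpa using h
    · rintro ⟨r, c⟩ h
      simp only [Finset.mem_filter, Finset.mem_univ, true_and] at h
      obtain ⟨⟨h1, h2⟩, hr⟩ := h
      have hc : c ∉ S := fun hc => by simp [consWord_of_mem hc] at h1
      refine ⟨(⟨r, hr⟩, ⟨c, hc⟩), ?_, rfl⟩
      simpa [consWord_of_notMem hr, consWord_of_notMem hc] using And.intro h1 h2

theorem exists_consWord [Fintype ι] (w : ι → Fin (t + 1)) :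
    ∃ v, consWord {i | w i = 0} v = w := by
  refine ⟨fun i => (w i.1).pred (by simpa using i.2), funext fun i => ?_⟩
  by_cases hi : w i = 0
  · rw [consWord_of_mem (by simpa using hi), hi]
  · rw [consWord_of_notMem (by simpa using hi), Fin.succ_pred]

theorem consWord_injective (S : Finset ι) :
    Function.Injective (consWord S : ({i // i ∉ S} → Fin t) → ι → Fin (t + 1)) := by
  intro v v' h
  ext ⟨i, hi⟩ : 1
  have := congrFun h i
  rwa [consWord_of_notMem hi, consWord_of_notMem hi, Fin.succ_inj] at this

end Words

/-- Words with prescribed letter multiplicities are counted by `wordInv` with generating function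
the `q`-multinomial coefficient. -/
theorem sum_wordInv {t : ℕ} : ∀ {ι : Type} [Fintype ι] [DecidableEq ι] (d : Fin t → ℕ)
    (p : Fin t → ι → ℕ), (∀ k, Function.Injective (p k)) → ∑ k, d k = Fintype.card ι →
    (∑ w : ι → Fin t with ∀ k, #{i | w i = k} = d k, (RatFunc.X : RatFunc ℚ) ^ wordInv p w) *
      ∏ k, qFactorial (d k) = qFactorial (Fintype.card ι) := by
  induction t with
  | zero =>
    intro ι _ _ d p _ hd
    have h0 : Fintype.card ι = 0 := by simpa using hd.symm
    have : IsEmpty ι := Fintype.card_eq_zero_iff.1 h0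
    simp [qFactorial_zero, wordInv]
  | succ t ih =>
    intro ι _ _ d p hp hd
    rw [Fin.sum_univ_succ] at hd
    have key : ∑ w : ι → Fin (t + 1) with ∀ k, #{i | w i = k} = d k,
          (RatFunc.X : RatFunc ℚ) ^ wordInv p w =
        ∑ S ∈ (Finset.univ : Finset ι).powersetCard (d 0),
          ∑ v : {i // i ∉ S} → Fin t with ∀ k, #{i | v i = k} = d k.succ,
            RatFunc.X ^ wordInv p (consWord S v) := by
      rw [Finset.sum_sigma']
      symm
      refine Finset.sum_bij (fun x _ => consWord x.1 x.2) ?_ ?_ ?_ fun _ _ => rfl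
      · rintro ⟨S, v⟩ h
        simp only [Finset.mem_sigma, Finset.mem_powersetCard, Finset.subset_univ, true_and,
          Finset.mem_filter, Finset.mem_univ] at h ⊢
        intro k
        cases k using Fin.cases with
        | zero => simpa [consWord_eq_zero_iff] using h.1
        | succ k => rw [card_consWord_succ, h.2]
      · rintro ⟨S, v⟩ - ⟨S', v'⟩ - h
        dsimp only at h
        obtain rfl : S = S' := by
          ext i
          rw [← consWord_eq_zero_iff (v := v), h, consWord_eq_zero_iff]
        rw [consWord_injective S h]
      · intro w hw
        obtain ⟨v, hv⟩ := exists_consWord w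
        simp only [Finset.mem_filter, Finset.mem_univ, true_and] at hw
        refine ⟨⟨_, v⟩, ?_, hv⟩
        simp only [Finset.mem_sigma, Finset.mem_powersetCard, Finset.subset_univ, true_and,
          Finset.mem_filter, Finset.mem_univ]
        exact ⟨hw 0, fun k => by rw [← card_consWord_succ, hv, hw]⟩
    rw [key, Fin.prod_univ_succ, ← Finset.card_univ,
      ← sum_powersetCard_crossInv (hp 0) Finset.univ (d 0) (∑ k : Fin t, d k.succ) hd,
      Finset.sum_mul, Finset.sum_mul]
    refine Finset.sum_congr rfl fun S hS => ?_
    have hS : #S = d 0 := (Finset.mem_powersetCard.1 hS).2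
    have hcard : Fintype.card {i // i ∉ S} = ∑ k : Fin t, d k.succ := by
      rw [Fintype.card_subtype_compl, Fintype.card_coe, ← hd, hS]
      omega
    -- The restricted rankings depend on `S`, but the resulting sum does not, so it factors out.
    have e := ih (ι := {i // i ∉ S}) (fun k => d k.succ) (fun k i => p k.succ i.1)
      (fun k => (hp k.succ).comp Subtype.val_injective) hcard.symm
    simp only [wordInv_consWord, pow_add, ← Finset.mul_sum, ← Finset.compl_eq_univ_sdiff]
    rw [hcard] at e
    rw [← e]
    ring

/-! ### Regularity as sorting by cyclic rank -/

/-- The height of the board in the columns of the `k`-th block. -/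
def blockHeight {t : ℕ} (h : Fin t → ℕ) (k : Fin t) : ℕ :=
  ∑ m ∈ Finset.Iic k, h m

/-- The rank of row `i` when the rows are read cyclically upwards, starting with the lowest row
of a column of height `H`. -/
def cyclicRank (n H i : ℕ) : ℕ :=
  if i < H then H - i else n + H - i

theorem cyclicRank_injective (n H : ℕ) :
    Function.Injective fun i : Fin n => cyclicRank n H i := by
  intro i j hij
  have hi := i.2
  have hj := j.2
  simp only [cyclicRank] at hij
  apply Fin.ext
  split_ifs at hij <;> omega

section Board

variable {t n : ℕ} {h d : Fin t → ℕ} {k l : Fin t}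

theorem InBlock.lt_of_lt {i j : ℕ} (hi : InBlock d k i) (hj : InBlock d l j) (hkl : k < l) :
    i < j :=
  hi.2.trans_le <| (Finset.sum_le_sum_of_subset fun _ hm =>
    Finset.mem_Iio.2 ((Finset.mem_Iic.1 hm).trans_lt hkl)).trans hj.1

theorem InBlock.unique {j : ℕ} (hk : InBlock d k j) (hl : InBlock d l j) : k = l := by
  rcases lt_trichotomy k l with hkl | hkl | hkl
  · exact absurd (hk.lt_of_lt hl hkl) (lt_irrefl j)
  · exact hkl
  · exact absurd (hl.lt_of_lt hk hkl) (lt_irrefl j)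

theorem mem_board_iff {c : Fin n × Fin n} (hc : InBlock d k c.2) :
    c ∈ board n h d ↔ (c.1 : ℕ) < blockHeight h k := by
  simp only [board, Finset.mem_filter, Finset.mem_univ, true_and, blockHeight]
  constructor
  · rintro ⟨l, hl, hlt⟩
    rwa [hc.unique hl]
  · exact fun hlt => ⟨k, hc, hlt⟩

theorem isSection_block (n : ℕ) (h d : Fin t → ℕ) (k : Fin t) :
    IsSection (board n h d) {j | InBlock d k j} := by
  refine ⟨⟨fun i hi j hj l hl => ⟨hi.1.trans hl.1, lt_of_le_of_lt hl.2 hj.2⟩⟩, ?_⟩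
  have aux : ∀ j : Fin n, InBlock d k j →
      colHeight (board n h d) j = #{r : Fin n | (r : ℕ) < blockHeight h k} := by
    intro j hj
    refine Finset.card_nbij' Prod.fst (fun r => (r, j)) ?_ ?_ ?_ ?_
    · rintro ⟨r, c⟩ hc
      simp only [Finset.coe_filter, Set.mem_ofPred_eq] at hc
      obtain ⟨hc, rfl⟩ := hc
      simpa using (mem_board_iff hj).1 hc
    · intro r hr
      simpa using (mem_board_iff (c := (r, j)) hj).2 (by simpa using hr)
    · rintro ⟨r, c⟩ hc
      simp only [Finset.coe_filter, Set.mem_ofPred_eq] at hc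
      rw [hc.2]
    · intro r _
      rfl
  intro i hi j hj
  rw [aux i hi, aux j hj]

/-- Rows on the board precede rows off it in cyclic rank, and lower rows come first within each
kind, so the three clauses merge into one. Whole blocks suffice, since they are sections themselves.
-/
theorem isRegular_iff {τ : Equiv.Perm (Fin n)} :
    IsRegular n h d τ ↔ ∀ (k : Fin t) (i j : Fin n), InBlock d k (τ i) → InBlock d k (τ j) →
      cyclicRank n (blockHeight h k) i < cyclicRank n (blockHeight h k) j → τ i < τ j := by
  constructor
  · intro hτ k i j hi hj hij
    have hreg := hτ _ (isSection_block n h d k) ⟨k, fun _ hx => hx⟩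
    obtain ⟨h1, -, -⟩ := hreg i j hi hj
    obtain ⟨-, h2, h3⟩ := hreg j i hj hi
    have hBi := mem_board_iff (h := h) (c := (i, τ i)) hi
    have hBj := mem_board_iff (h := h) (c := (j, τ j)) hj
    rw [hBi, hBj] at h1 h2 h3
    have := i.2
    have := j.2
    simp only [Fin.lt_def] at *
    unfold cyclicRank at hij
    split_ifs at hij with hiH hjH hjH
    · exact h2 hjH hiH (by omega)
    · exact h1 hiH hjH
    · omega
    · exact h3 hjH hiH (by omega)
  · rintro hτ D - ⟨k, hD⟩ i j hiD hjD
    have hi := hD _ hiD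
    have hj := hD _ hjD
    have hij := hτ k i j hi hj
    have hji := hτ k j i hj hi
    rw [mem_board_iff hi, mem_board_iff hj]
    have := i.2
    have := j.2
    simp only [Fin.lt_def] at *
    unfold cyclicRank at hij hji
    refine ⟨fun hiH hjH => hij ?_, fun hiH hjH hlt => hji ?_, fun hiH hjH hlt => hji ?_⟩
    · rw [if_pos hiH, if_neg hjH]; omega
    · rw [if_pos hiH, if_pos hjH]; omega
    · rw [if_neg hiH, if_neg hjH]; omega

/-- The key by which the rows are sorted in the regular graph of `w`: first by letter, then in
the cyclic order of the block. -/
def regularKey (h : Fin t → ℕ) (w : Fin n → Fin t) (i : Fin n) : Fin t ×ₗ ℕ :=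
  toLex (w i, cyclicRank n (blockHeight h (w i)) i)

theorem regularKey_lt_iff {w : Fin n → Fin t} {i j : Fin n} :
    regularKey h w i < regularKey h w j ↔ w i < w j ∨ w i = w j ∧
      cyclicRank n (blockHeight h (w i)) i < cyclicRank n (blockHeight h (w i)) j := by
  rw [regularKey, regularKey, Prod.Lex.toLex_lt_toLex]
  dsimp only
  refine or_congr_right (and_congr_right fun hij => ?_)
  rw [hij]

theorem regularKey_injective (h : Fin t → ℕ) (w : Fin n → Fin t) :
    Function.Injective (regularKey h w) := by
  intro i j hij
  obtain ⟨h1, h2⟩ := Prod.mk.inj (toLex.injective hij)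
  rw [h1] at h2
  exact cyclicRank_injective n _ h2

/-- A graph already orders the columns of rows with distinct letters; regularity settles the ties.
-/
theorem IsGraph.isRegular_iff_strictMono_key {w : Fin n → Fin t} {τ : Equiv.Perm (Fin n)}
    (hτ : IsGraph d w τ) :
    IsRegular n h d τ ↔ ∀ i j, regularKey h w i < regularKey h w j → τ i < τ j := by
  rw [isRegular_iff]
  constructor
  · intro hreg i j hij
    rcases regularKey_lt_iff.1 hij with hlt | ⟨heq, hlt⟩
    · exact (hτ i).lt_of_lt (hτ j) hlt
    · exact hreg (w i) i j (hτ i) (heq ▸ hτ j) hlt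
  · intro hreg k i j hi hj hij
    obtain rfl := hi.unique (hτ i)
    exact hreg i j (regularKey_lt_iff.2 (Or.inr ⟨hj.unique (hτ j), hij⟩))

end Board

/-! ### Permutations that sort injective keys -/

section Sorting

variable {n : ℕ} {α : Type*} [LinearOrder α] {f : Fin n → α}

theorem apply_lt_apply_iff_of_strictMono_key (hf : Function.Injective f) {τ : Equiv.Perm (Fin n)}
    (hτ : ∀ i j, f i < f j → τ i < τ j) (i j : Fin n) : τ i < τ j ↔ f i < f j := by
  refine ⟨fun hij => ?_, hτ i j⟩
  rcases lt_trichotomy (f i) (f j) with hlt | heq | hgt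
  · exact hlt
  · exact absurd hij (by simp [hf heq])
  · exact absurd (hτ j i hgt) hij.asymm

/-- A permutation sorting the keys `f` counts the smaller keys. -/
theorem apply_eq_card_of_strictMono_key (hf : Function.Injective f) {τ : Equiv.Perm (Fin n)}
    (hτ : ∀ i j, f i < f j → τ i < τ j) (i : Fin n) : (τ i : ℕ) = #{c | f c < f i} := by
  simp only [← apply_lt_apply_iff_of_strictMono_key hf hτ]
  rw [← Fin.card_Iio (τ i)]
  symm
  refine Finset.card_equiv τ fun c => ?_
  simp

theorem exists_perm_strictMono_key (hf : Function.Injective f) :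
    ∃ τ : Equiv.Perm (Fin n), ∀ i j, f i < f j → τ i < τ j := by
  have hcard : ∀ i, #{c | f c < f i} < n := fun i => by
    have : #{c | f c < f i} < #(Finset.univ : Finset (Fin n)) :=
      Finset.card_lt_card (Finset.filter_ssubset.2 ⟨i, by simp⟩)
    simpa using this
  have hmono : ∀ i j, f i < f j → #{c | f c < f i} < #{c | f c < f j} := fun i j hij =>
    Finset.card_lt_card <| (Finset.ssubset_iff_of_subset fun c hc => by
      simp only [Finset.mem_filter, Finset.mem_univ, true_and] at hc ⊢
      exact hc.trans hij).2 ⟨i, by simpa using hij, by simp⟩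
  have hinj : Function.Injective fun i => (⟨_, hcard i⟩ : Fin n) := by
    intro i j hij
    have hij : #{c | f c < f i} = #{c | f c < f j} := congrArg Fin.val hij
    rcases lt_trichotomy (f i) (f j) with hlt | heq | hgt
    · exact absurd hij (hmono i j hlt).ne
    · exact hf heq
    · exact absurd hij (hmono j i hgt).ne'
  exact ⟨Equiv.ofBijective _ (Finite.injective_iff_bijective.1 hinj), hmono⟩

end Sorting

/-! ### The regular graph and its circles -/

section RegularGraph

variable {t n : ℕ} {h d : Fin t → ℕ} {w : Fin n → Fin t}

theorem card_filter_mem_of_mem_words (hw : w ∈ words n d) (s : Finset (Fin t)) :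
    #{i | w i ∈ s} = ∑ k ∈ s, d k := by
  simp only [words, Finset.mem_filter, Finset.mem_univ, true_and] at hw
  rw [Finset.card_eq_sum_card_fiberwise (f := w) (t := s) fun i hi => by simpa using hi]
  refine Finset.sum_congr rfl fun k hk => ?_
  rw [← hw k, Finset.filter_filter]
  congr 1
  ext i
  simp only [Finset.mem_filter, Finset.mem_univ, true_and, and_iff_right_iff_imp]
  rintro rfl
  exact hk

/-- The number of keys below that of `i` is at least the number of letters `< w i` and, as `i`
itself is not counted, less than the number of letters `≤ w i`. -/
theorem isGraph_of_strictMono_key (hw : w ∈ words n d) {τ : Equiv.Perm (Fin n)}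
    (hτ : ∀ i j, regularKey h w i < regularKey h w j → τ i < τ j) : IsGraph d w τ := by
  intro i
  rw [InBlock, apply_eq_card_of_strictMono_key (regularKey_injective h w) hτ,
    ← card_filter_mem_of_mem_words hw, ← card_filter_mem_of_mem_words hw]
  constructor
  · refine Finset.card_le_card fun c hc => ?_
    simp only [Finset.mem_filter, Finset.mem_univ, true_and, Finset.mem_Iio] at hc ⊢
    exact regularKey_lt_iff.2 (Or.inl hc)
  · refine Finset.card_lt_card <| (Finset.ssubset_iff_of_subset fun c hc => ?_).2
      ⟨i, by simp, by simp⟩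
    simp only [Finset.mem_filter, Finset.mem_univ, true_and, Finset.mem_Iic] at hc ⊢
    exact (regularKey_lt_iff.1 hc).elim le_of_lt fun hc => hc.1.le

/-- Every word in `M(d)` has exactly one regular graph. -/
theorem existsUnique_regularGraph (h : Fin t → ℕ) (hw : w ∈ words n d) :
    ∃! τ : Equiv.Perm (Fin n), IsGraph d w τ ∧ IsRegular n h d τ := by
  have hinj := regularKey_injective h w
  obtain ⟨τ, hτ⟩ := exists_perm_strictMono_key hinj
  have hg := isGraph_of_strictMono_key hw hτ
  refine ⟨τ, ⟨hg, hg.isRegular_iff_strictMono_key.2 hτ⟩, ?_⟩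
  rintro τ' ⟨hg', hr'⟩
  have hτ' := hg'.isRegular_iff_strictMono_key.1 hr'
  ext i
  rw [apply_eq_card_of_strictMono_key hinj hτ, apply_eq_card_of_strictMono_key hinj hτ']

theorem isCircled_iff {τ : Equiv.Perm (Fin n)} (hτ : IsGraph d w τ) (r c : Fin n) :
    IsCircled (board n h d) τ (c, τ r) ↔ τ r < τ c ∧
      cyclicRank n (blockHeight h (w r)) c < cyclicRank n (blockHeight h (w r)) r := by
  have hB : ∀ x : Fin n, (x, τ r) ∈ board n h d ↔ (x : ℕ) < blockHeight h (w r) :=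
    fun x => mem_board_iff (c := (x, τ r)) (hτ r)
  have := r.2
  have := c.2
  simp only [IsCircled, IsEmptyCell, EmbeddingLike.apply_eq_iff_eq, exists_eq_left, hB]
  refine and_congr_right fun _ => ?_
  simp only [cyclicRank, Fin.lt_def]
  split_ifs <;> omega

/-- Dworkin's statistic of a regular graph is an inversion number of the word. -/
theorem xi_eq_wordInv {τ : Equiv.Perm (Fin n)} (hg : IsGraph d w τ) (hr : IsRegular n h d τ) :
    xi (board n h d) τ = wordInv (fun k (i : Fin n) => cyclicRank n (blockHeight h k) i) w := by
  have hτ := apply_lt_apply_iff_of_strictMono_key (regularKey_injective h w)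
    (hg.isRegular_iff_strictMono_key.1 hr)
  rw [xi, wordInv]
  symm
  -- The pair `(r, c)` goes to the square in row `c` and the column of the rook of row `r`.
  refine Finset.card_equiv ((Equiv.prodComm _ _).trans ((Equiv.refl _).prodCongr τ)) ?_
  rintro ⟨r, c⟩
  simp only [Finset.mem_filter, Finset.mem_univ, true_and, Equiv.trans_apply,
    Equiv.prodComm_apply, Prod.swap_prod_mk, Equiv.prodCongr_apply, Prod.map_apply,
    Equiv.refl_apply, isCircled_iff hg, hτ, regularKey_lt_iff]
  -- For equal letters, emptiness and circling ask for opposite rank inequalities.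
  refine and_congr_left fun hlt => ⟨Or.inl, ?_⟩
  rintro (hw | ⟨-, hgt⟩)
  · exact hw
  · exact absurd hgt hlt.asymm

theorem xiWord_eq_wordInv (h : Fin t → ℕ) (hw : w ∈ words n d) :
    xiWord h d w = wordInv (fun k (i : Fin n) => cyclicRank n (blockHeight h k) i) w := by
  obtain ⟨hg, hr⟩ : IsGraph d w (regularGraph h d w) ∧ IsRegular n h d (regularGraph h d w) :=
    Classical.epsilon_spec (existsUnique_regularGraph h hw).exists
  exact xi_eq_wordInv hg hr

end RegularGraph

end Rook

theorem theorem4 (t n : ℕ) (h d : Fin t → ℕ) (hd : ∀ k, 0 < d k) (hn : ∑ k, d k = n)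
    (hh : ∑ k, h k ≤ n) :
    (∀ w ∈ Rook.words n d, ∃! τ : Equiv.Perm (Fin n),
      Rook.IsGraph d w τ ∧ Rook.IsRegular n h d τ) ∧
    ∑ w ∈ Rook.words n d, (RatFunc.X : RatFunc ℚ) ^ Rook.xiWord h d w =
      Rook.qMultinomial n d := by
  refine ⟨fun w hw => Rook.existsUnique_regularGraph h hw, ?_⟩
  rw [Rook.qMultinomial, eq_div_iff (Finset.prod_ne_zero_iff.2 fun k _ =>
    Rook.qFactorial_ne_zero (d k)),
    Finset.sum_congr rfl fun w hw => by rw [Rook.xiWord_eq_wordInv h hw]]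
  have key := Rook.sum_wordInv d
    (fun k (i : Fin n) => Rook.cyclicRank n (Rook.blockHeight h k) i)
    (fun k => Rook.cyclicRank_injective n _) (by simpa using hn)
  rwa [Fintype.card_fin] at key
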